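/- Regard a real Hilbert space $H$ as a many-sorted metric structure in continuous logic: for every integer $n\ge 1$ there is a sort, interpreted by the closed ball $B_n(H)$ of radius $n$ with the metric $\|x-y\|$, and the symbols are the zero vector, the inclusions $B_m\to B_n$ for $m\le n$, addition $B_n\times B_n\to B_{2n}$, multiplication by each $r\in\mathbb R$, $B_n\to B_{n\lceil |r|\rceil}$ (into $B_n$ if $r=0$), and the inner product $B_n\times B_n\to[-n^2,n^2]$. Let $P:H\to H$ be a bounded linear operator with $P^2=P$ and $P^*=P$ such that there are infinitely many pairwise orthonormal vectors $v$ with $P(v)=v$ and infinitely many pairwise orthonormal vectors $u$ with $P(u)=0$ (that is, $(H,P)$ is a model of the theory $T^P_\omega$). Put $d_P(v)=\|v-P(v)\|$. Let $(H,P)$ be the expansion of the structure $H$ by the function symbols $P:B_n\to B_n$, and let $(H,d_P)$ be the expansion of the structure $H$ by the predicates $d_P:B_n\to\mathbb R$, for all $n\ge 1$. Here a predicate on a finite product of sorts is *definable* in a structure if it is a uniform limit of a sequence of (interpretations of) formulas without parameters of continuous logic, and a function $f$ is definable if the predicate $(x,y)\mapsto d(f(x),y)$ is definable. Then the projection $P$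 is definable in $(H,d_P)$: for every $n\ge1$ the function $P:B_n(H)\to B_n(H)$ is definable in $(H,d_P)$. Conversely, $d_P$ is definable in $(H,P)$: for every $n\ge1$ the predicate $d_P:B_n(H)\to\mathbb R$ is definable in $(H,P)$. So $(H,P)$ and $(H,d_P)$ are interdefinable, in the sense that each of the symbols $P$ and $d_P$ is definable in the structure given by the other. -/

import Mathlib

open Filter Topology

universe u

noncomputable section

/-! ### Many-sorted continuous logic -/

/-- A many-sorted signature for metric structures. Every sort also carries a symbol for its
metric, which is built into the formulas below. -/
structure MetricLanguage where
  Srt : Type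
  Func : Type
  arity : Func → ℕ
  dom : (f : Func) → Fin (arity f) → Srt
  cod : Func → Srt
  Pred : Type
  predArity : Pred → ℕ
  predDom : (p : Pred) → Fin (predArity p) → Srt

/-- A metric structure: every sort is a nonempty bounded complete metric space, the function
symbols are interpreted by uniformly continuous functions, and the predicate symbols by uniformly
continuous bounded real functions. -/
structure MetricStructure (L : MetricLanguage) where
  carrier : L.Srt → Type u
  [metric : ∀ s, MetricSpace (carrier s)]
  [complete : ∀ s, CompleteSpace (carrier s)]
  [bounded : ∀ s, BoundedSpace (carrier s)]
  [nonempty : ∀ s, Nonempty (carrier s)]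
  funMap : (f : L.Func) → (∀ i, carrier (L.dom f i)) → carrier (L.cod f)
  funMap_uniformContinuous : ∀ f, UniformContinuous (funMap f)
  predMap : (p : L.Pred) → (∀ i, carrier (L.predDom p i)) → ℝ
  predMap_uniformContinuous : ∀ p, UniformContinuous (predMap p)
  predMap_bounded : ∀ p, ∃ C : ℝ, ∀ v, |predMap p v| ≤ C

attribute [instance] MetricStructure.metric MetricStructure.complete MetricStructure.bounded
  MetricStructure.nonempty

namespace MetricLanguage

/-- Terms of the language `L` whose variables are `x₀, …, x_{n-1}`, with `xᵢ` of sort `Γ i`. -/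
inductive Term (L : MetricLanguage) {n : ℕ} (Γ : Fin n → L.Srt) : L.Srt → Type
  | var (i : Fin n) : Term L Γ (Γ i)
  | app (f : L.Func) (args : ∀ i, Term L Γ (L.dom f i)) : Term L Γ (L.cod f)

/-- Formulas of continuous logic with free variables among `x₀, …, x_{n-1}`, with `xᵢ` of sort
`Γ i`, and without parameters. The connectives are all continuous real functions of finitely many
real variables, the quantifiers are `sup` and `inf` over a sort; the quantified variable is the new
variable `0` of the context. -/
inductive Formula (L : MetricLanguage) : {n : ℕ} → (Fin n → L.Srt) → Type
  | dist {n : ℕ} {Γ : Fin n → L.Srt} {s : L.Srt} (t₁ t₂ : L.Term Γ s) : Formula L Γ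
  | pred {n : ℕ} {Γ : Fin n → L.Srt} (p : L.Pred) (args : ∀ i, L.Term Γ (L.predDom p i)) :
      Formula L Γ
  | conn {n : ℕ} {Γ : Fin n → L.Srt} {k : ℕ} (c : C(Fin k → ℝ, ℝ)) (φ : Fin k → Formula L Γ) :
      Formula L Γ
  | sup {n : ℕ} {Γ : Fin n → L.Srt} (s : L.Srt)
      (φ : Formula L (Fin.cons s Γ : Fin (n + 1) → L.Srt)) : Formula L Γ
  | inf {n : ℕ} {Γ : Fin n → L.Srt} (s : L.Srt)
      (φ : Formula L (Fin.cons s Γ : Fin (n + 1) → L.Srt)) : Formula L Γ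

end MetricLanguage

namespace MetricStructure

variable {L : MetricLanguage}

/-- Assignments of elements of `M` to the variables of the context `Γ`. -/
abbrev Tuple (M : MetricStructure.{u} L) {n : ℕ} (Γ : Fin n → L.Srt) : Type u :=
  ∀ i, M.carrier (Γ i)

/-- Put the element `a` of sort `s` in front of the tuple `v`. -/
def Tuple.cons (M : MetricStructure.{u} L) {n : ℕ} {Γ : Fin n → L.Srt} {s : L.Srt}
    (a : M.carrier s) (v : M.Tuple Γ) : M.Tuple (Fin.cons s Γ : Fin (n + 1) → L.Srt) :=
  fun i => Fin.cases (motive := fun i => M.carrier ((Fin.cons s Γ : Fin (n + 1) → L.Srt) i))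
    a (fun j => v j) i

/-- The value of a term. -/
def termValue (M : MetricStructure.{u} L) {n : ℕ} {Γ : Fin n → L.Srt} (v : M.Tuple Γ) :
    {s : L.Srt} → L.Term Γ s → M.carrier s
  | _, .var i => v i
  | _, .app f args => M.funMap f (fun i => M.termValue v (args i))

/-- The value of a formula. -/
def eval (M : MetricStructure.{u} L) :
    {n : ℕ} → {Γ : Fin n → L.Srt} → L.Formula Γ → M.Tuple Γ → ℝ
  | _, _, .dist t₁ t₂, v => dist (M.termValue v t₁) (M.termValue v t₂)
  | _, _, .pred p args, v => M.predMap p (fun i => M.termValue v (args i))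
  | _, _, .conn c φ, v => c (fun i => M.eval (φ i) v)
  | _, _, .sup s φ, v => ⨆ a : M.carrier s, M.eval φ (Tuple.cons M a v)
  | _, _, .inf s φ, v => ⨅ a : M.carrier s, M.eval φ (Tuple.cons M a v)

/-- `Q` is a definable predicate of `M` (without parameters): it is a uniform limit of the
interpretations of a sequence of formulas. -/
def DefinablePred (M : MetricStructure.{u} L) {n : ℕ} (Γ : Fin n → L.Srt)
    (Q : M.Tuple Γ → ℝ) : Prop :=
  ∃ φ : ℕ → L.Formula Γ, TendstoUniformly (fun k v => M.eval (φ k) v) Q atTop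

/-- `f` is a definable function of `M` (without parameters): `(y, x) ↦ d(f(x), y)` is a definable
predicate of `M`. -/
def DefinableFun (M : MetricStructure.{u} L) {n : ℕ} (Γ : Fin n → L.Srt) (t : L.Srt)
    (f : M.Tuple Γ → M.carrier t) : Prop :=
  M.DefinablePred (Fin.cons t Γ : Fin (n + 1) → L.Srt)
    (fun w => dist (f (fun i => w i.succ)) (w 0 : M.carrier t))

end MetricStructure

/-! ### Hilbert spaces as metric structures

The sort `n ≥ 1` is the closed ball of radius `n`. -/

/-- Function symbols of the language of Hilbert spaces: the zero vector, the inclusions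
`B_m → B_n` for `m ≤ n`, addition `B_n × B_n → B_{2n}`, and multiplication by the real number `r`
from `B_n` to `B_{n⌈|r|⌉}` (to `B_n` for `r = 0`). -/
inductive HilbertFunc : Type
  | zero : HilbertFunc
  | incl (m n : ℕ+) (h : m ≤ n) : HilbertFunc
  | add (n : ℕ+) : HilbertFunc
  | smul (r : ℝ) (n : ℕ+) : HilbertFunc

namespace HilbertFunc

/-- `⌈|r|⌉`, replaced by `1` for `r = 0`. -/
def scale (r : ℝ) : ℕ+ := ⟨max 1 ⌈|r|⌉₊, lt_of_lt_of_le Nat.one_pos (le_max_left _ _)⟩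

lemma abs_le_scale (r : ℝ) : |r| ≤ ((scale r : ℕ) : ℝ) := by
  have h : ⌈|r|⌉₊ ≤ (scale r : ℕ) := le_max_right 1 _
  exact (Nat.le_ceil _).trans (by exact_mod_cast h)

def arity : HilbertFunc → ℕ
  | zero => 0
  | incl _ _ _ => 1
  | add _ => 2
  | smul _ _ => 1

def dom : (f : HilbertFunc) → Fin f.arity → ℕ+
  | zero => fun _ => 1
  | incl m _ _ => fun _ => m
  | add n => fun _ => n
  | smul _ n => fun _ => n

def cod : HilbertFunc → ℕ+
  | zero => 1
  | incl _ n _ => n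
  | add n => 2 * n
  | smul r n => n * scale r

end HilbertFunc

/-- The language of Hilbert spaces with a unary function symbol `P : B_n → B_n` for every `n`.
The predicate symbols are the inner products `B_n × B_n → [-n², n²]`. -/
def projLanguage : MetricLanguage where
  Srt := ℕ+
  Func := HilbertFunc ⊕ ℕ+
  arity := fun f => match f with
    | .inl g => g.arity
    | .inr _ => 1
  dom := fun f => match f with
    | .inl g => g.dom
    | .inr n => fun _ => n
  cod := fun f => match f with
    | .inl g => g.cod
    | .inr n => n
  Pred := ℕ+
  predArity := fun _ => 2
  predDom := fun n _ => n

/-- The language of Hilbert spaces with a unary predicate symbol `d_P` on `B_n` for every `n`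
(the right summand); the left summand holds the inner products. -/
def distLanguage : MetricLanguage where
  Srt := ℕ+
  Func := HilbertFunc
  arity := HilbertFunc.arity
  dom := HilbertFunc.dom
  cod := HilbertFunc.cod
  Pred := ℕ+ ⊕ ℕ+
  predArity := fun p => match p with
    | .inl _ => 2
    | .inr _ => 1
  predDom := fun p => match p with
    | .inl n => fun _ => n
    | .inr n => fun _ => n

section Hilbert

set_option linter.unusedSectionVars false

variable (H : Type u) [NormedAddCommGroup H] [InnerProductSpace ℝ H]

/-- The closed ball of radius `n` around `0`. -/
abbrev HBall (n : ℕ+) : Type u := Metric.closedBall (0 : H) (n : ℝ)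

variable {H}

lemma HBall.norm_le {n : ℕ+} (x : HBall H n) : ‖(x : H)‖ ≤ n := by
  exact mem_closedBall_zero_iff.1 x.2

/-- The interpretation of the function symbols of the language of Hilbert spaces. -/
def hilbertFunMap : (f : HilbertFunc) → (∀ i, HBall H (f.dom i)) → HBall H f.cod
  | .zero => fun _ => ⟨0, by simp⟩
  | .incl m n h => fun v => ⟨((v (0 : Fin 1) : HBall H m) : H), by
      have h1 := HBall.norm_le (v (0 : Fin 1) : HBall H m)
      have h2 : (m : ℝ) ≤ n := by exact_mod_cast h
      rw [mem_closedBall_zero_iff]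
      exact h1.trans h2⟩
  | .add n => fun v =>
      ⟨((v (0 : Fin 2) : HBall H n) : H) + ((v (1 : Fin 2) : HBall H n) : H), by
      have h1 := HBall.norm_le (v (0 : Fin 2) : HBall H n)
      have h2 := HBall.norm_le (v (1 : Fin 2) : HBall H n)
      rw [mem_closedBall_zero_iff]
      have h3 : (((HilbertFunc.add n).cod : ℕ+) : ℝ) = n + n := by
        simp [HilbertFunc.cod, two_mul]
      rw [h3]
      exact (norm_add_le _ _).trans (add_le_add h1 h2)⟩
  | .smul r n => fun v => ⟨r • ((v (0 : Fin 1) : HBall H n) : H), by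
      have h1 := HBall.norm_le (v (0 : Fin 1) : HBall H n)
      rw [mem_closedBall_zero_iff, norm_smul, Real.norm_eq_abs]
      have h3 : (((HilbertFunc.smul r n).cod : ℕ+) : ℝ) = n * HilbertFunc.scale r := by
        simp [HilbertFunc.cod]
      rw [h3, mul_comm]
      exact mul_le_mul h1 (HilbertFunc.abs_le_scale r) (abs_nonneg _) (Nat.cast_nonneg _)⟩

/-- The inner product `B_n × B_n → [-n², n²]`. -/
def hilbertInner (n : ℕ+) (v : Fin 2 → HBall H n) : ℝ := inner ℝ (v 0 : H) (v 1 : H)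

lemma hilbertFunMap_uniformContinuous (f : HilbertFunc) :
    UniformContinuous (hilbertFunMap (H := H) f) := by
  cases f with
  | zero => exact uniformContinuous_const
  | incl m n h =>
    exact UniformContinuous.subtype_mk (uniformContinuous_subtype_val.comp
      (Pi.uniformContinuous_proj (fun _ : Fin 1 => HBall H m) 0)) _
  | add n =>
    exact UniformContinuous.subtype_mk ((uniformContinuous_subtype_val.comp
      (Pi.uniformContinuous_proj (fun _ : Fin 2 => HBall H n) 0)).add
      (uniformContinuous_subtype_val.comp
      (Pi.uniformContinuous_proj (fun _ : Fin 2 => HBall H n) 1))) _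
  | smul r n =>
    exact UniformContinuous.subtype_mk ((uniformContinuous_subtype_val.comp
      (Pi.uniformContinuous_proj (fun _ : Fin 1 => HBall H n) 0)).const_smul r) _

lemma hilbertInner_bounded (n : ℕ+) (v : Fin 2 → HBall H n) :
    |hilbertInner n v| ≤ (n : ℝ) * n :=
  (abs_real_inner_le_norm _ _).trans
    (mul_le_mul (HBall.norm_le _) (HBall.norm_le _) (norm_nonneg _) (by positivity))

lemma hilbertInner_uniformContinuous (n : ℕ+) :
    UniformContinuous (hilbertInner (H := H) n) := by
  have hn : (0 : ℝ) < n := by exact_mod_cast n.pos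
  refine LipschitzWith.uniformContinuous (K := 2 * (n : NNReal))
    (LipschitzWith.of_dist_le_mul fun v w => ?_)
  have e : hilbertInner n v - hilbertInner n w
      = inner ℝ ((v 0 : H) - w 0) (v 1 : H) + inner ℝ (w 0 : H) ((v 1 : H) - w 1) := by
    simp only [hilbertInner, inner_sub_left, inner_sub_right]; ring
  have h0 : ‖(v 0 : H) - w 0‖ ≤ dist v w := by
    rw [← dist_eq_norm]; exact dist_le_pi_dist v w 0
  have h1 : ‖(v 1 : H) - w 1‖ ≤ dist v w := by
    rw [← dist_eq_norm]; exact dist_le_pi_dist v w 1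
  rw [Real.dist_eq, e]
  have a := (abs_real_inner_le_norm ((v 0 : H) - w 0) (v 1 : H)).trans
    (mul_le_mul h0 (HBall.norm_le _) (norm_nonneg _) dist_nonneg)
  have b := (abs_real_inner_le_norm (w 0 : H) ((v 1 : H) - w 1)).trans
    (mul_le_mul (HBall.norm_le _) h1 (norm_nonneg _) hn.le)
  refine (abs_add_le _ _).trans ((add_le_add a b).trans (le_of_eq ?_))
  push_cast
  ring

/-- `P` is an orthogonal projection: `P² = P` and `P* = P`. -/
structure IsOrthogonalProjection (P : H →L[ℝ] H) : Prop where
  idem : ∀ v, P (P v) = P v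
  symm : ∀ u v, inner ℝ (P u) v = inner ℝ u (P v)

/-- `(H, P)` is a model of the theory `T^P_ω`: `P` is an orthogonal projection, there are infinitely many
pairwise orthonormal vectors fixed by `P`, and infinitely many pairwise orthonormal vectors
killed by `P`. -/
structure IsModelTPOmega (P : H →L[ℝ] H) : Prop extends IsOrthogonalProjection P where
  infinite_range : ∃ e : ℕ → H, Orthonormal ℝ e ∧ ∀ i, P (e i) = e i
  infinite_ker : ∃ e : ℕ → H, Orthonormal ℝ e ∧ ∀ i, P (e i) = 0

lemma IsOrthogonalProjection.norm_le {P : H →L[ℝ] H} (hP : IsOrthogonalProjection P) (v : H) :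
    ‖P v‖ ≤ ‖v‖ := by
  have h : ‖P v‖ * ‖P v‖ ≤ ‖v‖ * ‖P v‖ := by
    rw [← real_inner_self_eq_norm_mul_norm, hP.symm, hP.idem]
    exact real_inner_le_norm _ _
  rcases (norm_nonneg (P v)).eq_or_lt with h0 | h0
  · rw [← h0]; exact norm_nonneg _
  · exact le_of_mul_le_mul_right h h0

/-- The projection as a map from the ball of radius `n` to itself. -/
def projBall {P : H →L[ℝ] H} (hP : IsOrthogonalProjection P) (n : ℕ+) (x : HBall H n) :
    HBall H n :=
  ⟨P x, by rw [mem_closedBall_zero_iff]; exact (hP.norm_le _).trans (HBall.norm_le x)⟩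

/-- The distance to the subspace `P(H)`, that is `d_P(v) = ‖v - P v‖`, on the ball of radius
`n`. -/
def distBall (P : H →L[ℝ] H) (n : ℕ+) (x : HBall H n) : ℝ := ‖(x : H) - P x‖

lemma projBall_uniformContinuous {P : H →L[ℝ] H} (hP : IsOrthogonalProjection P) (n : ℕ+) :
    UniformContinuous (projBall hP n) :=
  UniformContinuous.subtype_mk (P.uniformContinuous.comp uniformContinuous_subtype_val) _

lemma distBall_uniformContinuous (P : H →L[ℝ] H) (n : ℕ+) :
    UniformContinuous (distBall P n) :=
  uniformContinuous_norm.comp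
    (uniformContinuous_subtype_val.sub (P.uniformContinuous.comp uniformContinuous_subtype_val))

lemma distBall_bounded {P : H →L[ℝ] H} (hP : IsOrthogonalProjection P) (n : ℕ+)
    (x : HBall H n) : |distBall P n x| ≤ (n : ℝ) + n := by
  rw [distBall, abs_norm]
  exact (norm_sub_le _ _).trans
    (add_le_add (HBall.norm_le x) ((hP.norm_le _).trans (HBall.norm_le x)))

lemma HBall.boundedSpace (n : ℕ+) : BoundedSpace (HBall H n) :=
  boundedSpace_subtype_iff.2 Metric.isBounded_closedBall

variable [CompleteSpace H]

lemma HBall.completeSpace (n : ℕ+) : CompleteSpace (HBall H n) :=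
  Metric.isClosed_closedBall.completeSpace_coe

/-- The structure `(H, P)`. -/
def projStructure {P : H →L[ℝ] H} (hP : IsOrthogonalProjection P) :
    MetricStructure.{u} projLanguage where
  carrier := fun n => HBall H n
  metric := fun n => inferInstanceAs (MetricSpace (HBall H n))
  complete := fun n => HBall.completeSpace (H := H) n
  bounded := fun n => HBall.boundedSpace (H := H) n
  nonempty := fun _ => ⟨⟨0, by simp⟩⟩
  funMap := fun f => match f with
    | .inl g => hilbertFunMap g
    | .inr n => fun v => projBall hP n (v (0 : Fin 1))
  funMap_uniformContinuous := fun f => match f with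
    | .inl g => hilbertFunMap_uniformContinuous g
    | .inr n => (projBall_uniformContinuous hP n).comp
        (Pi.uniformContinuous_proj (fun _ : Fin 1 => HBall H n) 0)
  predMap := fun n => hilbertInner n
  predMap_uniformContinuous := fun n => hilbertInner_uniformContinuous n
  predMap_bounded := fun n => ⟨_, hilbertInner_bounded n⟩

/-- The structure `(H, d_P)`. -/
def distStructure {P : H →L[ℝ] H} (hP : IsOrthogonalProjection P) :
    MetricStructure.{u} distLanguage where
  carrier := fun n => HBall H n
  metric := fun n => inferInstanceAs (MetricSpace (HBall H n))
  complete := fun n => HBall.completeSpace (H := H) n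
  bounded := fun n => HBall.boundedSpace (H := H) n
  nonempty := fun _ => ⟨⟨0, by simp⟩⟩
  funMap := fun f => hilbertFunMap f
  funMap_uniformContinuous := fun f => hilbertFunMap_uniformContinuous f
  predMap := fun p => match p with
    | .inl n => hilbertInner n
    | .inr n => fun v => distBall P n (v (0 : Fin 1))
  predMap_uniformContinuous := fun p => match p with
    | .inl n => hilbertInner_uniformContinuous n
    | .inr n => (distBall_uniformContinuous P n).comp
        (Pi.uniformContinuous_proj (fun _ : Fin 1 => HBall H n) 0)
  predMap_bounded := fun p => match p with
    | .inl n => ⟨_, hilbertInner_bounded n⟩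
    | .inr n => ⟨_, fun v => distBall_bounded hP n (v (0 : Fin 1))⟩

end Hilbert

end

/-! Both directions are explicit: one quantifier-free formula suffices, with no genuine limit. From
`P` one gets `d_P` at once, since `d_P(x) = d(x, P x)`. For the converse, put `Q = 1 - P`, again an
orthogonal projection, so that `d_P(x) = ‖Q x‖`. Then `‖P x‖² = ‖x‖² - d_P(x)²` by Pythagoras, and
`⟪P x, y⟫ = ⟪x, y⟫ - ⟪Q x, Q y⟫`, where polarization gives `2⟪Q x, Q y⟫ = d_P(x + y)² - d_P(x)² -
d_P(y)²`. Substituting in `‖P x - y‖² = ‖P x‖² - 2⟪P x, y⟫ + ‖y‖²` leaves only inner products and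
values of `d_P` (`norm_apply_sub_sq`); a square root, which is a continuous connective, then yields
the graph predicate of `P`. -/

section Hilbert

variable {H : Type u} [NormedAddCommGroup H] [InnerProductSpace ℝ H]

/-- The projection is recovered from the distance to its range, by polarization. -/
lemma IsOrthogonalProjection.norm_apply_sub_sq {P : H →L[ℝ] H} (hP : IsOrthogonalProjection P)
    (x y : H) :
    ‖P x - y‖ ^ 2 = inner ℝ x x - 2 * inner ℝ x y + inner ℝ y y
      + ‖(x + y) - P (x + y)‖ ^ 2 - 2 * ‖x - P x‖ ^ 2 - ‖y - P y‖ ^ 2 := by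
  -- Self-adjointness and idempotence remove the second `P`, so after expansion only products with
  -- at most one `P` remain.
  have key (u v : H) : inner ℝ (P u) (P v) = inner ℝ (P u) v := by
    rw [hP.symm u (P v), hP.idem, hP.symm]
  have hxx := key x x
  have hyy := key y y
  have hxy := key x y
  -- Expanding `d_P(x + y)²` produces both mixed terms `⟪P x, y⟫` and `⟪P y, x⟫`; this identifies
  -- them.
  have hyx := hP.symm y x
  simp only [← real_inner_self_eq_norm_sq, map_add, inner_sub_left, inner_sub_right,
    inner_add_left, inner_add_right]
  -- Each inner product gets a fixed order of its arguments, so that the goal becomes linear in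
  -- common atoms.
  simp only [real_inner_comm (P _) x, real_inner_comm (P _) y, real_inner_comm x y,
    real_inner_comm (P x) (P y)] at *
  linarith

end Hilbert

/-- A predicate that is the interpretation of a single formula is definable. -/
lemma MetricStructure.definablePred_of_eval_eq {L : MetricLanguage} {M : MetricStructure.{u} L}
    {n : ℕ} {Γ : Fin n → L.Srt} {Q : M.Tuple Γ → ℝ} (φ : L.Formula Γ)
    (h : ∀ v, M.eval φ v = Q v) : M.DefinablePred Γ Q := by
  obtain rfl : (fun v => M.eval φ v) = Q := funext h
  -- The constant sequence serves as the uniformly convergent one.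
  refine ⟨fun _ => φ, Metric.tendstoUniformly_iff.2 fun ε hε => ?_⟩
  exact Eventually.of_forall fun _ v => by rwa [dist_self]

/-- The formula `d_P` in the language with a symbol for `P`: `d(x, P x)`. -/
def distFormula (n : ℕ+) : projLanguage.Formula (fun _ : Fin 1 => (n : projLanguage.Srt)) :=
  .dist (s := (n : projLanguage.Srt)) (.var 0)
    (.app (L := projLanguage) (.inr n) fun _ => .var 0)

/-- The context of the graph of `P` on the ball of radius `n`: the variable `0` stands for the
value and the variable `1` for the argument. -/
abbrev graphContext (n : ℕ+) : Fin 2 → distLanguage.Srt :=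
  Fin.cons (n : distLanguage.Srt) (fun _ : Fin 1 => (n : distLanguage.Srt))

/-- The connective expressing `‖P x - y‖` by the values of `⟪x, x⟫`, `⟪x, y⟫`, `⟪y, y⟫`,
`d_P (x + y)`, `d_P x` and `d_P y`. -/
noncomputable def graphConnective : C(Fin 6 → ℝ, ℝ) where
  -- A connective must be continuous on all of `ℝ⁶`; `√` is `0` at negative arguments, so no
  -- restriction on `z` is needed.
  toFun z := √(z 0 - 2 * z 1 + z 2 + z 3 ^ 2 - 2 * z 4 ^ 2 - z 5 ^ 2)
  continuous_toFun := by fun_prop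

/-- The variable for the argument of `P`. -/
def argTerm (n : ℕ+) : distLanguage.Term (graphContext n) n := .var 1

/-- The variable for the value of `P`. -/
def valTerm (n : ℕ+) : distLanguage.Term (graphContext n) n := .var 0

/-- The inner product of two terms. -/
def innerFormula {k : ℕ} {Γ : Fin k → distLanguage.Srt} {n : ℕ+}
    (s t : distLanguage.Term Γ n) : distLanguage.Formula Γ :=
  .pred (L := distLanguage) (.inl n) fun i : Fin 2 => if i = 0 then s else t

/-- The predicate `d_P` at a term. -/
def distPredFormula {k : ℕ} {Γ : Fin k → distLanguage.Srt} {n : ℕ+}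
    (t : distLanguage.Term Γ n) : distLanguage.Formula Γ :=
  .pred (L := distLanguage) (.inr n) fun _ => t

/-- The sum of two terms. -/
def addTerm {k : ℕ} {Γ : Fin k → distLanguage.Srt} {n : ℕ+}
    (s t : distLanguage.Term Γ n) : distLanguage.Term Γ (2 * n : ℕ+) :=
  .app (L := distLanguage) (.add n) fun i : Fin 2 => if i = 0 then s else t

/-- A quantifier-free formula for `‖P x - y‖` in the language with a symbol for `d_P`. -/
noncomputable def graphFormula (n : ℕ+) : distLanguage.Formula (graphContext n) :=
  .conn graphConnective
    ![innerFormula (argTerm n) (argTerm n), innerFormula (argTerm n) (valTerm n),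
      -- The sum lies in the ball of radius `2n`, so here `d_P` is the symbol of sort `2 * n`, while
      -- the other two occurrences have sort `n`.
      innerFormula (valTerm n) (valTerm n), distPredFormula (addTerm (argTerm n) (valTerm n)),
      distPredFormula (argTerm n), distPredFormula (valTerm n)]

section Eval

variable {H : Type u} [NormedAddCommGroup H] [InnerProductSpace ℝ H] [CompleteSpace H]
  {P : H →L[ℝ] H} (hP : IsOrthogonalProjection P)

lemma eval_distFormula (n : ℕ+)
    (v : (projStructure hP).Tuple (fun _ : Fin 1 => (n : projLanguage.Srt))) :
    (projStructure hP).eval (distFormula n) v = distBall P n (v 0) :=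
  dist_eq_norm (E := H) _ _

lemma eval_graphFormula (n : ℕ+) (w : (distStructure hP).Tuple (graphContext n)) :
    (distStructure hP).eval (graphFormula n) w
      = dist (projBall hP n (w 1)) (w 0 : HBall H n) := by
  have h : (distStructure hP).eval (graphFormula n) w
      = √(inner ℝ (w 1 : HBall H n).1 (w 1 : HBall H n).1
        - 2 * inner ℝ (w 1 : HBall H n).1 (w 0 : HBall H n).1
        + inner ℝ (w 0 : HBall H n).1 (w 0 : HBall H n).1
        + ‖((w 1 : HBall H n).1 + (w 0 : HBall H n).1)
            - P ((w 1 : HBall H n).1 + (w 0 : HBall H n).1)‖ ^ 2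
        - 2 * ‖(w 1 : HBall H n).1 - P (w 1 : HBall H n).1‖ ^ 2
        - ‖(w 0 : HBall H n).1 - P (w 0 : HBall H n).1‖ ^ 2) := rfl
  -- By the polarization identity the radicand is a perfect square, so the root is the norm itself.
  rw [h, ← hP.norm_apply_sub_sq, Real.sqrt_sq (norm_nonneg _)]
  exact (dist_eq_norm (E := H) _ _).symm

end Eval

theorem mainTheorem11 {H : Type u} [NormedAddCommGroup H] [InnerProductSpace ℝ H]
    [CompleteSpace H] (P : H →L[ℝ] H) (hP : IsModelTPOmega P) :
    (∀ n : ℕ+, (distStructure hP.toIsOrthogonalProjection).DefinableFun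
      (fun _ : Fin 1 => n) n (fun v => projBall hP.toIsOrthogonalProjection n (v 0))) ∧
    (∀ n : ℕ+, (projStructure hP.toIsOrthogonalProjection).DefinablePred
      (fun _ : Fin 1 => n) (fun v => distBall P n (v 0))) := by
  -- `DefinableFun` unfolds to definability of the graph predicate with the value as variable `0`,
  -- the order used in `graphContext`.
  exact ⟨fun n => MetricStructure.definablePred_of_eval_eq (graphFormula n)
      (eval_graphFormula hP.toIsOrthogonalProjection n),
    fun n => MetricStructure.definablePred_of_eval_eq (distFormula n)
      (eval_distFormula hP.toIsOrthogonalProjection n)⟩
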